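/- **Setting.** Let $\Omega$ be a countable discrete state space, and let $\mathcal F$ be a countable family of flaws, each flaw $f$ being a subset of $\Omega$. For every flaw $f$ and state $\sigma\in f$ a resampling oracle gives a probability distribution $A_f[\sigma,\cdot]$ on $\Omega$; put $A_f[\sigma,\cdot]=0$ for $\sigma\notin f$. Let $\mu$ be a probability distribution on $\Omega$. The local search algorithm draws the initial state from $\mu$ and, as long as some flaw holds on the current state $\sigma$, selects a flaw $f\ni\sigma$ by an arbitrary rule (which may depend on the past and be randomized) and moves to a new state drawn from $A_f[\sigma,\cdot]$; it stops at a flawless state. For $E\subseteq\Omega$ let $P(E)$ be the probability that the state is in $E$ at some time (including time $0$). Let $\sim$ be a reflexive symmetric relation on $\mathcal F$ such that for distinct $f\not\sim g$, resampling $f$ never leads from a state outside $g$ into $g$. Assume that the oracle is *T-commutative*, i.e. $A_fA_g=A_gA_f$ whenever $f\not\sim g$, and *injective*, i.e. for every flaw $f$ and state $\sigma$ there is at most one state $\tau$ with $A_f[\tau,\sigma]>0$. A *wdag* is a finite directed acyclic graph $H$ whose nodes $v$ carry labels $L(v)\in\mathcal F$, such that two distinct nodes $v,w$ are joined by an edge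 (in one of the directions) iff $L(v)\sim L(w)$; wdags are taken up to isomorphism. $\mathrm{sink}(H)$ is the set of labels of the sink nodes. The matrix $A_H$ is the identity if $H$ is empty, and otherwise $A_H=A_{L(v)}A_{H-v}$ for any source node $v$. A *prefix* of $H$ is an induced subgraph $H'$ that contains, with each node $v$, every $u$ having an edge $u\to v$; it is strict if $H'\neq H$. For $E\subseteq\Omega$ let $e_E$ be its indicator vector, $e_\sigma=e_{\{\sigma\}}$, and let $\mathfrak A(E)$ be the set of pairs $(H,\sigma)$ with $\sigma\in E$ such that no strict prefix $H'$ of $H$ has $e_E^\top A_{H-H'}e_\sigma>0$. Let $\gamma_f=\sup_{\tau}\sum_{\sigma\in f}\frac{\mu(\sigma)}{\mu(\tau)}A_f[\sigma,\tau]$, $w(H)=\prod_{v\in H}\gamma_{L(v)}$, $\Psi(I)=\sum_{H:\,\mathrm{sink}(H)=I}w(H)$ and $\overline\Psi(I)=\sum_{J\subseteq I}\Psi(J)$, all with values in $[0,\infty]$, where $0/0=0$ and $0\cdot\infty=0$. Let $\tilde\Gamma(E,\sigma)$ be the set of flaws $f$ with $A_f[\tau,\sigma]>0$ for some $\tau\notin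 E$, and $\tilde\Gamma(E)=\bigcup_{\sigma\in E}\tilde\Gamma(E,\sigma)$. Suprema over the empty set are $0$; over non-empty finite sets they are maxima. **Theorem.** For every $E\subseteq\Omega$, $$P(E)\le\sum_{(H,\sigma)\in\mathfrak A(E)}\mu^\top A_He_\sigma .$$ Assume moreover that the divisions in the definition of $\gamma_f$ make sense: $\mu(\sigma)>0$ and $A_f[\sigma,\tau]>0$ imply $\mu(\tau)>0$ (for instance, $\mu>0$ everywhere). Then, for every $E\subseteq\Omega$, with $\mathfrak A^+(E)=\{(H,\sigma)\in\mathfrak A(E): A_He_\sigma\ne0\}$, $$P(E)\le\sum_{(H,\sigma)\in\mathfrak A(E)}\mu(\sigma)w(H),$$ $$P(E)\le\sum_{(H,\sigma)\in\mathfrak A^+(E)}\mu(\sigma)w(H)\le\sum_{\sigma\in E}\mu(\sigma)\,\overline\Psi(\tilde\Gamma(E,\sigma))\le\mu(E)\cdot\sup_{\sigma\in E}\overline\Psi(\tilde\Gamma(E,\sigma)),$$ and in particular $P(E)\le\mu(E)\cdot\sup_{\sigma\in E}\overline\Psi(\tilde\Gamma(E,\sigma))$. If for every flaw $f$ and every $\sigma\in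 E$ there is a state $\tau$ with $A_f[\tau,\sigma]>0$, then also $\sum_{(H,\sigma)\in\mathfrak A(E)}\mu(\sigma)w(H)\le\sum_{\sigma\in E}\mu(\sigma)\overline\Psi(\tilde\Gamma(E,\sigma))$. Finally, under the same assumption on $\mu$, for every collection $\mathcal C$ of events, with $E=\bigcup_{C\in\mathcal C}C$, $$P(E)\le\mu(E)\cdot\sup_{C\in\mathcal C}\overline\Psi(\tilde\Gamma(C)).$$ -/

import Mathlib

open MeasureTheory
open scoped ENNReal

noncomputable section

namespace LocalSearch

/-! ### Vectors and matrices over a discrete state space, with entries in `[0, ∞]` -/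

/-- The matrix product `(A B)[σ, τ] = ∑_ρ A[σ, ρ] B[ρ, τ]`. -/
def mmul {Ω : Type*} (A B : Ω → Ω → ℝ≥0∞) : Ω → Ω → ℝ≥0∞ :=
  fun σ τ => ∑' ρ, A σ ρ * B ρ τ

open Classical in
/-- The identity matrix. -/
def idMat {Ω : Type*} : Ω → Ω → ℝ≥0∞ :=
  fun σ τ => if σ = τ then 1 else 0

/-- The indicator vector `e_E`; the basis vector `e_σ` is `ind {σ}`. -/
def ind {Ω : Type*} (E : Set Ω) : Ω → ℝ≥0∞ :=
  E.indicator (fun _ => 1)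

/-- The scalar `uᵀ M v`. -/
def form {Ω : Type*} (u : Ω → ℝ≥0∞) (M : Ω → Ω → ℝ≥0∞) (v : Ω → ℝ≥0∞) : ℝ≥0∞ :=
  ∑' σ, ∑' τ, u σ * M σ τ * v τ

/-! ### Resampling oracles -/

/-- A family of flaws, indexed by `F`, on the state space `Ω`, with a resampling oracle:
`resample f σ` is the law of the new state when `f` is resampled at `σ`.
Its values at states outside of the flaw `f` are never used. -/
structure ResamplingOracle (Ω F : Type*) where
  flaw : F → Set Ω
  resample : F → Ω → PMF Ω

open Classical in
/-- The transition matrix `A_f`; its rows at states outside of `f` vanish. -/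
def ResamplingOracle.trans {Ω F : Type*} (R : ResamplingOracle Ω F) (f : F) :
    Ω → Ω → ℝ≥0∞ :=
  fun σ τ => if σ ∈ R.flaw f then R.resample f σ τ else 0

/-- `rel` is a dependence relation for the oracle: it is reflexive and symmetric, and for
distinct unrelated flaws `f, g`, resampling `f` never leads from a state outside of `g` into `g`
(the statement for `f` and `g` exchanged follows by symmetry). -/
structure IsDependence {Ω F : Type*} (R : ResamplingOracle Ω F) (rel : F → F → Prop) : Prop where
  refl : ∀ f, rel f f
  symm : ∀ f g, rel f g → rel g f
  not_cause : ∀ f g, f ≠ g → ¬ rel f g →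
    ∀ σ τ, σ ∉ R.flaw g → τ ∈ R.flaw g → R.trans f σ τ = 0

/-- T-commutativity: the transition matrices of unrelated flaws commute. -/
def IsTCommutative {Ω F : Type*} (R : ResamplingOracle Ω F) (rel : F → F → Prop) : Prop :=
  ∀ f g, ¬ rel f g → mmul (R.trans f) (R.trans g) = mmul (R.trans g) (R.trans f)

/-- Injectivity: for every flaw `f` and state `σ`, at most one state is mapped by `f` to `σ`
with positive probability. -/
def IsInjective {Ω F : Type*} (R : ResamplingOracle Ω F) : Prop :=
  ∀ f σ τ τ', 0 < R.trans f τ σ → 0 < R.trans f τ' σ → τ = τ'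

/-! ### Executions of the local search algorithm -/

/-- `X t` is the state at time `t` and `φ t` is the flaw which is selected in that state
(`none` when the algorithm has stopped), in an execution of the local search algorithm with
initial distribution `μ`, realised on a probability space `(W, ℙ)`.  The flaw selection rule is
arbitrary: `φ t` may depend on the whole past and on further randomness, as long as, given the past
up to and including the selection of a flaw `f` at time `t`, the next state is distributed
according to the oracle for `f` at the current state. -/
structure IsExecution {Ω F W : Type*} [MeasurableSpace W] (R : ResamplingOracle Ω F)
    (μ : PMF Ω) (ℙ : Measure W) (X : ℕ → W → Ω) (φ : ℕ → W → Option F) : Prop where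
  measurable_state : ∀ t σ, MeasurableSet {ω | X t ω = σ}
  measurable_flaw : ∀ t o, MeasurableSet {ω | φ t ω = o}
  /-- The initial state has law `μ`. -/
  init : ∀ σ, ℙ {ω | X 0 ω = σ} = μ σ
  /-- A selected flaw holds on the current state. -/
  select : ∀ t, ∀ᵐ ω ∂ℙ, ∀ f, φ t ω = some f → X t ω ∈ R.flaw f
  /-- The algorithm stops only at flawless states. -/
  terminal : ∀ t, ∀ᵐ ω ∂ℙ, φ t ω = none → ∀ f, X t ω ∉ R.flaw f
  /-- Once stopped, the state does not change any more. -/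
  halt : ∀ t, ∀ᵐ ω ∂ℙ, φ t ω = none → X (t + 1) ω = X t ω
  /-- The law of the next state; the past up to time `t` is `x 0, g 0, …, x t, g t`. -/
  step : ∀ (t : ℕ) (x : ℕ → Ω) (g : ℕ → Option F) (f : F) (τ : Ω), g t = some f →
    ℙ {ω | (∀ s ≤ t, X s ω = x s ∧ φ s ω = g s) ∧ X (t + 1) ω = τ} =
      ℙ {ω | ∀ s ≤ t, X s ω = x s ∧ φ s ω = g s} * R.resample f (x t) τ

/-- `P(E)`, the probability that the event `E` occurs at any time. -/
def occurProb {Ω W : Type*} [MeasurableSpace W] (ℙ : Measure W) (X : ℕ → W → Ω)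
    (E : Set Ω) : ℝ≥0∞ :=
  ℙ {ω | ∃ t, X t ω ∈ E}

/-! ### Witness DAGs -/

/-- A (finite) witness DAG: an acyclic directed graph with nodes labelled by flaws, in which two
distinct nodes are joined by an edge, in one of the directions, iff their labels are related. -/
structure Wdag {F : Type*} (rel : F → F → Prop) where
  n : ℕ
  label : Fin n → F
  edge : Fin n → Fin n → Prop
  acyclic : ∀ v, ¬ Relation.TransGen edge v v
  edge_iff : ∀ v w, v ≠ w → ((edge v w ∨ edge w v) ↔ rel (label v) (label w))

/-- Isomorphism of wdags: a bijection of the nodes which preserves labels and edges. -/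
def Wdag.Iso {F : Type*} {rel : F → F → Prop} (G H : Wdag rel) : Prop :=
  ∃ e : Fin G.n ≃ Fin H.n, (∀ v, H.label (e v) = G.label v) ∧
    ∀ v w, H.edge (e v) (e w) ↔ G.edge v w

/-- Isomorphism is an equivalence relation. -/
def Wdag.setoid {F : Type*} (rel : F → F → Prop) : Setoid (Wdag rel) where
  r := Wdag.Iso
  iseqv :=
    { refl := fun G => ⟨Equiv.refl _, fun _ => rfl, fun _ _ => Iff.rfl⟩
      symm := by
        rintro G H ⟨e, h1, h2⟩
        refine ⟨e.symm, fun v => ?_, fun v w => ?_⟩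
        · rw [← h1, e.apply_symm_apply]
        · rw [← h2, e.apply_symm_apply, e.apply_symm_apply]
      trans := by
        rintro G H K ⟨e, h1, h2⟩ ⟨e', h1', h2'⟩
        refine ⟨e.trans e', fun v => ?_, fun v w => ?_⟩
        · rw [Equiv.trans_apply, h1', h1]
        · rw [Equiv.trans_apply, Equiv.trans_apply, h2', h2] }

/-- Wdags up to isomorphism.  Sums over wdags range over this type, and evaluate the summand, which
is invariant under isomorphism, at a representative. -/
def WdagClass {F : Type*} (rel : F → F → Prop) : Type _ :=
  Quotient (Wdag.setoid rel)

/-- A chosen wdag in an isomorphism class. -/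
def WdagClass.rep {F : Type*} {rel : F → F → Prop} (c : WdagClass rel) : Wdag rel :=
  Quotient.out (s := Wdag.setoid rel) c

/-- The set `sink(H)` of the labels of the sink nodes of `H`. -/
def Wdag.sink {F : Type*} {rel : F → F → Prop} (H : Wdag rel) : Set F :=
  {f | ∃ v, (∀ w, ¬ H.edge v w) ∧ H.label v = f}

/-- The matrix of the subgraph of `H` which is induced on a set `S` of nodes: choose an arbitrary
source node `v` of the subgraph, and multiply `A_{L(v)}` by the matrix of the subgraph without `v`;
the empty graph (the only one without a source node, by acyclicity) has the identity matrix. -/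
def Wdag.subMat {Ω F : Type*} {rel : F → F → Prop} (R : ResamplingOracle Ω F) (H : Wdag rel)
    (S : Finset (Fin H.n)) : Ω → Ω → ℝ≥0∞ :=
  open Classical in
  if h : ∃ v, v ∈ S ∧ ∀ u ∈ S, ¬ H.edge u v then
    mmul (R.trans (H.label h.choose)) (H.subMat R (S.erase h.choose))
  else idMat
termination_by S.card
decreasing_by exact Finset.card_erase_lt_of_mem h.choose_spec.1

/-- The matrix `A_H`. -/
def Wdag.mat {Ω F : Type*} {rel : F → F → Prop} (R : ResamplingOracle Ω F) (H : Wdag rel) :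
    Ω → Ω → ℝ≥0∞ :=
  H.subMat R Finset.univ

/-- Prefixes of `H`.  A subgraph of `H` which is itself a wdag is an induced subgraph, so it is
given by its set `S` of nodes; it is a prefix if with each node it contains all nodes that have an
edge to it.  It is strict, i.e. not isomorphic to `H`, iff `S ≠ Finset.univ`. -/
def Wdag.IsPrefix {F : Type*} {rel : F → F → Prop} (H : Wdag rel) (S : Finset (Fin H.n)) : Prop :=
  ∀ u v, H.edge u v → v ∈ S → u ∈ S

/-- The pair `(H, σ)` is `E`-minimal: `σ ∈ E`, and no strict prefix `H'` of `H` has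
`e_Eᵀ A_{H - H'} e_σ > 0`. -/
def IsMinimalPair {Ω F : Type*} {rel : F → F → Prop} (R : ResamplingOracle Ω F) (E : Set Ω)
    (H : Wdag rel) (σ : Ω) : Prop :=
  σ ∈ E ∧ ¬ ∃ S : Finset (Fin H.n), H.IsPrefix S ∧ S ≠ Finset.univ ∧
    0 < form (ind E) (H.subMat R Sᶜ) (ind {σ})

/-- The collection `𝔄(E)` of `E`-minimal pairs, with wdags taken up to isomorphism. -/
def minimalPairs {Ω F : Type*} (rel : F → F → Prop) (R : ResamplingOracle Ω F) (E : Set Ω) :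
    Set (WdagClass rel × Ω) :=
  {p | IsMinimalPair R E p.1.rep p.2}

/-! ### Charges and weights -/

/-- The charge `γ_f = max_τ ∑_{σ ∈ f} (μ(σ) / μ(τ)) A_f[σ, τ]`. -/
def charge {Ω F : Type*} (R : ResamplingOracle Ω F) (μ : PMF Ω) (f : F) : ℝ≥0∞ :=
  ⨆ τ, ∑' σ : R.flaw f, μ σ / μ τ * R.trans f σ τ

/-- The divisions in the definition of the charges make sense: a state of probability zero under
`μ` is never reached by resampling a flaw at a state of positive probability (a quotient `0 / 0` is
then read as `0`).  This holds in particular if `μ` is everywhere positive. -/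
def ChargesDefined {Ω F : Type*} (R : ResamplingOracle Ω F) (μ : PMF Ω) : Prop :=
  ∀ f σ τ, 0 < μ σ → 0 < R.trans f σ τ → 0 < μ τ

/-- The weight `w(H)`, the product of the charges of the labels. -/
def Wdag.weight {Ω F : Type*} {rel : F → F → Prop} (R : ResamplingOracle Ω F) (μ : PMF Ω)
    (H : Wdag rel) : ℝ≥0∞ :=
  ∏ v, charge R μ (H.label v)

/-- `Ψ(I) = ∑ w(H)`, over all wdags `H` with `sink(H) = I`. -/
def Psi {Ω F : Type*} (rel : F → F → Prop) (R : ResamplingOracle Ω F) (μ : PMF Ω)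
    (I : Set F) : ℝ≥0∞ :=
  ∑' c : {c : WdagClass rel // c.rep.sink = I}, c.1.rep.weight R μ

/-- `Ψ̄(I) = ∑_{J ⊆ I} Ψ(J)`. -/
def PsiBar {Ω F : Type*} (rel : F → F → Prop) (R : ResamplingOracle Ω F) (μ : PMF Ω)
    (I : Set F) : ℝ≥0∞ :=
  ∑' J : {J : Set F // J ⊆ I}, Psi rel R μ J.1

/-- `Γ̃(E, σ)`: the flaws which map some state outside of `E` to the state `σ ∈ E`. -/
def causesAt {Ω F : Type*} (R : ResamplingOracle Ω F) (E : Set Ω) (σ : Ω) : Set F :=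
  {f | ∃ τ, τ ∉ E ∧ 0 < R.trans f τ σ}

/-- `Γ̃(E)`: the flaws which can cause `E`. -/
def causes {Ω F : Type*} (R : ResamplingOracle Ω F) (E : Set Ω) : Set F :=
  ⋃ σ ∈ E, causesAt R E σ

/-- `μ(E)`. -/
def prob {Ω : Type*} (μ : PMF Ω) (E : Set Ω) : ℝ≥0∞ :=
  ∑' σ : E, μ σ

end LocalSearch

end

noncomputable section

namespace LocalSearch

/-! ### Matrix algebra over `[0, ∞]`. -/

section Matrices

variable {Ω : Type*}

/-! A wdag is handled through the words of labels read off its topological orders. All these words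
represent one trace, that is, they agree up to swapping unrelated letters, and T-commutativity makes
the product of the matrices `A_f` along a word depend only on the wdag.

If the run selects the word `l` and ends in `τ ∈ E`, factor the trace as `l = k m` so that `m` can
lead from some `ρ ∈ E` to `τ` and `k` is as short as possible. Then `k` is the wdag of an
`E`-minimal pair with second component `ρ` (`exists_minimalPair`). By a union bound over minimal
pairs it suffices that, for fixed `k` and `ρ`, such a factorisation ever appears with probability at
most `μᵀ A_k e_ρ`.

This is proved by induction on the number of steps (`measure_flawHistory_factorEvent_le`). Let `f`
be the flaw selected first. Either `f` is removed from `k`, and averaging over the next state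
restores the factor `A_f`; or `f` belongs to `m` and commutes with `k`, and `ρ` is replaced by its
possible successors `ρ'` under `f`. In the second case injectivity makes the bounds for the various
`ρ'` sum to at most the bound for `ρ` (`tsum_mul_wordMat_le`).

The weights enter through `μᵀ A_f ≤ γ_f μᵀ`, iterated along a word. For the bound by `Ψ̄`, deleting
a sink `v` of a minimal pair's wdag leaves a strict prefix, so `A_{L(v)}` cannot lead from `E` to
`σ`; if it leads to `σ` at all, then `L(v) ∈ Γ̃(E, σ)`. -/

lemma mmul_assoc (A B C : Ω → Ω → ℝ≥0∞) : mmul (mmul A B) C = mmul A (mmul B C) := by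
  funext σ τ
  simp only [mmul, ← ENNReal.tsum_mul_left, ← ENNReal.tsum_mul_right]
  rw [ENNReal.tsum_comm]
  simp only [mul_assoc]

lemma idMat_mmul (A : Ω → Ω → ℝ≥0∞) : mmul idMat A = A := by
  funext σ τ
  rw [mmul, tsum_eq_single σ]
  · simp [idMat]
  · intro b hb
    simp [idMat, hb.symm]

lemma mmul_idMat (A : Ω → Ω → ℝ≥0∞) : mmul A idMat = A := by
  funext σ τ
  rw [mmul, tsum_eq_single τ]
  · simp [idMat]
  · intro b hb
    simp [idMat, hb]

lemma mmul_pos_iff {A B : Ω → Ω → ℝ≥0∞} {σ τ : Ω} :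
    0 < mmul A B σ τ ↔ ∃ ρ, 0 < A σ ρ ∧ 0 < B ρ τ := by
  simp [mmul, pos_iff_ne_zero, ENNReal.tsum_eq_zero]

lemma form_ind_singleton (u : Ω → ℝ≥0∞) (M : Ω → Ω → ℝ≥0∞) (σ : Ω) :
    form u M (ind {σ}) = ∑' ρ, u ρ * M ρ σ := by
  refine tsum_congr fun ρ => ?_
  rw [tsum_eq_single σ]
  · simp [ind]
  · intro b hb
    simp [ind, hb]

lemma form_ind_pos_iff {E : Set Ω} {M : Ω → Ω → ℝ≥0∞} {σ : Ω} :
    0 < form (ind E) M (ind {σ}) ↔ ∃ ρ ∈ E, 0 < M ρ σ := by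
  rw [form_ind_singleton]
  simp [pos_iff_ne_zero, ENNReal.tsum_eq_zero, ind]

end Matrices

/-! ### Words of flaws and traces. -/

section Words

variable {Ω F : Type*} {rel : F → F → Prop} {R : ResamplingOracle Ω F}

/-- The product of the transition matrices along a word of flaws. -/
def wordMat (R : ResamplingOracle Ω F) : List F → Ω → Ω → ℝ≥0∞
  | [] => idMat
  | f :: l => mmul (R.trans f) (wordMat R l)

lemma wordMat_append (k m : List F) :
    wordMat R (k ++ m) = mmul (wordMat R k) (wordMat R m) := by
  induction k with
  | nil => simp [wordMat, idMat_mmul]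
  | cons f k ih => simp [wordMat, ih, mmul_assoc]

lemma mmul_wordMat_comm (hcomm : IsTCommutative R rel) {f : F} {k : List F}
    (h : ∀ g ∈ k, ¬ rel f g) :
    mmul (R.trans f) (wordMat R k) = mmul (wordMat R k) (R.trans f) := by
  induction k with
  | nil => simp [wordMat, idMat_mmul, mmul_idMat]
  | cons g k ih =>
    rw [wordMat, ← mmul_assoc, hcomm f g (h g (by simp)), mmul_assoc,
      ih fun g' hg' => h g' (by simp [hg']), mmul_assoc]

lemma wordMat_move_front (hcomm : IsTCommutative R rel) {f : F} {k₁ : List F} (k₂ : List F)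
    (h : ∀ g ∈ k₁, ¬ rel f g) :
    wordMat R (k₁ ++ f :: k₂) = mmul (R.trans f) (wordMat R (k₁ ++ k₂)) := by
  rw [wordMat_append, wordMat, ← mmul_assoc, ← mmul_wordMat_comm hcomm h, mmul_assoc,
    ← wordMat_append]

open Classical in
/-- Two words represent the same trace (element of the partially commutative monoid in which
unrelated letters commute): they have the same projection to every pair of related letters. -/
def TraceEq (rel : F → F → Prop) (l l' : List F) : Prop :=
  ∀ a b, rel a b →
    l.filter (fun c => decide (c = a ∨ c = b)) = l'.filter (fun c => decide (c = a ∨ c = b))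

lemma TraceEq.refl (l : List F) : TraceEq rel l l := fun _ _ _ => rfl

lemma TraceEq.symm {l l' : List F} (h : TraceEq rel l l') : TraceEq rel l' l :=
  fun a b hab => (h a b hab).symm

lemma TraceEq.trans {l l' l'' : List F} (h : TraceEq rel l l') (h' : TraceEq rel l' l'') :
    TraceEq rel l l'' :=
  fun a b hab => (h a b hab).trans (h' a b hab)

lemma TraceEq.append_right {l l' : List F} (h : TraceEq rel l l') (m : List F) :
    TraceEq rel (l ++ m) (l' ++ m) :=
  fun a b hab => by rw [List.filter_append, List.filter_append, h a b hab]

lemma TraceEq.mem_of_cons (hrefl : ∀ f, rel f f) {f : F} {l u : List F}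
    (h : TraceEq rel (f :: l) u) : f ∈ u := by
  have h1 := h f f (hrefl f)
  have : f ∈ (f :: l).filter (fun c => by classical exact decide (c = f ∨ c = f)) := by simp
  rw [h1] at this
  exact (List.mem_filter.1 this).1

/-- For `g` related to `f`, the left word projected to the letters `f, g` starts with `f`, while
`u₁` contains no `f`. Hence the projection of `u₁` is empty: no letter of `u₁` blocks the way of `f`
to the front. -/
lemma TraceEq.cancel_head (hsymm : ∀ f g, rel f g → rel g f) {f : F}
    {l u₁ u₂ : List F} (h : TraceEq rel (f :: l) (u₁ ++ f :: u₂)) (hf : f ∉ u₁) :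
    (∀ g ∈ u₁, ¬ rel f g) ∧ TraceEq rel l (u₁ ++ u₂) := by
  classical
  have key : ∀ g, rel f g → u₁.filter (fun c => decide (c = f ∨ c = g)) = [] := by
    intro g hg
    have h1 := h f g hg
    rw [List.filter_append] at h1
    cases h2 : u₁.filter (fun c => decide (c = f ∨ c = g)) with
    | nil => rfl
    | cons a t =>
      rw [h2] at h1
      have hfa : f = a := by simpa using (congrArg List.head? h1)
      have : a ∈ u₁.filter (fun c => decide (c = f ∨ c = g)) := by
        rw [h2]; exact List.mem_cons_self
      exact absurd (hfa ▸ (List.mem_filter.1 this).1) hf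
  refine ⟨fun g hg hr => ?_, fun a b hab => ?_⟩
  · have := List.filter_eq_nil_iff.1 (key g hr) g hg
    simp at this
  · have h1 := h a b hab
    by_cases hfab : f = a ∨ f = b
    · have h2 : u₁.filter (fun c => decide (c = a ∨ c = b)) = [] := by
        rcases hfab with rfl | rfl
        · exact key b hab
        · simpa only [or_comm] using key a (hsymm _ _ hab)
      rw [List.filter_append] at h1 ⊢
      rw [h2] at h1 ⊢
      simpa [hfab] using h1
    · simpa [List.filter_append, hfab] using h1

lemma TraceEq.length_eq (hrefl : ∀ f, rel f f) (hsymm : ∀ f g, rel f g → rel g f)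
    {l u : List F} (h : TraceEq rel l u) : l.length = u.length := by
  induction l generalizing u with
  | nil =>
    cases u with
    | nil => rfl
    | cons g u => simpa using h.symm.mem_of_cons hrefl
  | cons f l ih =>
    obtain ⟨u₁, u₂, rfl, hf⟩ := List.eq_append_cons_of_mem (h.mem_of_cons hrefl)
    have := ih (h.cancel_head hsymm hf).2
    simp at this ⊢
    omega

end Words

/-! ### Topological orders: wdags as traces, and the extraction of minimal pairs. -/

section Orderings

variable {Ω F : Type*} {rel : F → F → Prop} {R : ResamplingOracle Ω F}

/-- `L` lists the nodes in `S` in a topological order. -/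
structure Wdag.IsOrdering (H : Wdag rel) (S : Finset (Fin H.n)) (L : List (Fin H.n)) : Prop where
  nodup : L.Nodup
  mem_iff : ∀ v, v ∈ L ↔ v ∈ S
  pairwise : L.Pairwise fun u v => ¬ H.edge v u

lemma Wdag.IsOrdering.length_eq {H : Wdag rel} {S : Finset (Fin H.n)} {L : List (Fin H.n)}
    (h : H.IsOrdering S L) : L.length = S.card := by
  rw [← List.toFinset_card_of_nodup h.nodup]
  congr 1
  ext v
  simp [h.mem_iff]

lemma Wdag.exists_source (H : Wdag rel) {S : Finset (Fin H.n)} (hS : S.Nonempty) :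
    ∃ v, v ∈ S ∧ ∀ u ∈ S, ¬ H.edge u v := by
  have : Std.Irrefl (Relation.TransGen H.edge) := ⟨H.acyclic⟩
  have wf : WellFounded (Relation.TransGen H.edge) := Finite.wellFounded_of_trans_of_irrefl _
  obtain ⟨v, hv, h⟩ := wf.has_min (S : Set (Fin H.n)) hS
  exact ⟨v, hv, fun u hu he => h u hu (.single he)⟩

lemma Wdag.exists_ordering (H : Wdag rel) (S : Finset (Fin H.n)) :
    ∃ L, H.IsOrdering S L := by
  induction S using Finset.strongInduction with
  | H S ih =>
    rcases S.eq_empty_or_nonempty with rfl | hS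
    · exact ⟨[], by simp, by simp, by simp⟩
    · obtain ⟨v, hv, h⟩ := H.exists_source hS
      obtain ⟨L, hL⟩ := ih _ (Finset.erase_ssubset hv)
      refine ⟨v :: L, ?_, fun u => ?_, ?_⟩
      · exact List.nodup_cons.2 ⟨by simp [hL.mem_iff], hL.nodup⟩
      · rw [List.mem_cons, hL.mem_iff, Finset.mem_erase]
        by_cases huv : u = v <;> simp [huv, hv]
      · refine List.pairwise_cons.2 ⟨fun u hu => h u ?_, hL.pairwise⟩
        exact Finset.mem_of_mem_erase ((hL.mem_iff u).1 hu)

/-- The source chosen by the recursion can be moved to the front of any topological order: an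
earlier node related to it would be joined to it by an edge, which contradicts either the source
property or the order. Thus the choices in `subMat` do not matter. -/
lemma Wdag.IsOrdering.subMat_eq (hcomm : IsTCommutative R rel) {H : Wdag rel}
    {S : Finset (Fin H.n)} {L : List (Fin H.n)} (hL : H.IsOrdering S L) :
    H.subMat R S = wordMat R (L.map H.label) := by
  induction S using Finset.strongInduction generalizing L with
  | H S ih =>
    rw [Wdag.subMat]
    split_ifs with h
    · generalize hv : h.choose = v
      obtain ⟨hvS, hsrc⟩ := hv ▸ h.choose_spec
      obtain ⟨L₁, L₂, rfl⟩ := List.append_of_mem ((hL.mem_iff v).2 hvS)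
      have hnd := hL.nodup
      rw [List.nodup_middle, List.nodup_cons] at hnd
      have hpw := List.pairwise_append.1 hL.pairwise
      have hL' : H.IsOrdering (S.erase v) (L₁ ++ L₂) := by
        refine ⟨hnd.2, fun u => ?_, ?_⟩
        · rw [Finset.mem_erase, ← hL.mem_iff]
          constructor
          · intro hu
            refine ⟨fun he => hnd.1 (he ▸ hu), ?_⟩
            simp only [List.mem_append, List.mem_cons] at hu ⊢
            tauto
          · rintro ⟨hne, hu⟩
            simp only [List.mem_append, List.mem_cons] at hu ⊢
            tauto
        · exact hL.pairwise.sublist (List.Sublist.append_left (List.sublist_cons_self _ _) _)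
      rw [ih _ (Finset.erase_ssubset hvS) hL', List.map_append, List.map_append, List.map_cons,
        wordMat_move_front hcomm]
      intro g hg hrel
      obtain ⟨u, hu, rfl⟩ := List.mem_map.1 hg
      have hne : v ≠ u := fun he => hnd.1 (by simp [he, hu])
      rcases (H.edge_iff v u hne).2 hrel with he | he
      · exact hpw.2.2 u hu v (by simp) he
      · exact hsrc u ((hL.mem_iff u).1 (by simp [hu])) he
    · have hS : S = ∅ := by
        by_contra hS
        exact h (H.exists_source (Finset.nonempty_iff_ne_empty.2 hS))
      have : L = [] := List.eq_nil_iff_forall_not_mem.2 fun v => by simp [hL.mem_iff, hS]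
      simp [this, wordMat]

/-- Nodes labelled by two related flaws `a, b` are pairwise joined by edges (equal labels by
reflexivity), so all topological orders list them in the same way. -/
lemma Wdag.IsOrdering.traceEq (hrefl : ∀ f, rel f f) (hsymm : ∀ f g, rel f g → rel g f)
    {H : Wdag rel} {S : Finset (Fin H.n)} {L L' : List (Fin H.n)}
    (hL : H.IsOrdering S L) (hL' : H.IsOrdering S L') :
    TraceEq rel (L.map H.label) (L'.map H.label) := by
  classical
  intro a b hab
  rw [List.filter_map, List.filter_map]
  congr 1
  refine List.Perm.eq_of_pairwise (le := fun u v => ¬ H.edge v u) ?_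
    (hL.pairwise.filter _) (hL'.pairwise.filter _) (List.Perm.filter _ ?_)
  · intro u v hu hv h1 h2
    by_contra hne
    have hu' := (List.mem_filter.1 hu).2
    have hv' := (List.mem_filter.1 hv).2
    simp only [Function.comp_apply, decide_eq_true_eq] at hu' hv'
    have hr : rel (H.label u) (H.label v) := by
      rcases hu' with h | h <;> rcases hv' with h' | h' <;> rw [h, h']
      exacts [hrefl _, hab, hsymm _ _ hab, hrefl _]
    exact ((H.edge_iff u v hne).2 hr).elim h2 h1
  · exact (List.perm_ext_iff_of_nodup hL.nodup hL'.nodup).2 fun v => by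
      rw [hL.mem_iff, hL'.mem_iff]

/-- A word of labels of a wdag, read in some topological order. -/
def Wdag.word (H : Wdag rel) : List F :=
  (H.exists_ordering Finset.univ).choose.map H.label

lemma Wdag.IsOrdering.traceEq_word (hrefl : ∀ f, rel f f) (hsymm : ∀ f g, rel f g → rel g f)
    {H : Wdag rel} {L : List (Fin H.n)} (hL : H.IsOrdering Finset.univ L) :
    TraceEq rel (L.map H.label) H.word :=
  hL.traceEq hrefl hsymm (H.exists_ordering Finset.univ).choose_spec

lemma Wdag.length_word (H : Wdag rel) : H.word.length = H.n := by
  rw [Wdag.word, List.length_map, (H.exists_ordering Finset.univ).choose_spec.length_eq]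
  simp

lemma Wdag.mat_eq (hcomm : IsTCommutative R rel) (H : Wdag rel) :
    H.mat R = wordMat R H.word :=
  (H.exists_ordering Finset.univ).choose_spec.subMat_eq hcomm

lemma Wdag.weight_eq (μ : PMF Ω) (H : Wdag rel) :
    H.weight R μ = (H.word.map (charge R μ)).prod := by
  rw [Wdag.word, List.map_map, Wdag.weight]
  generalize hL : (H.exists_ordering Finset.univ).choose = L
  have h : H.IsOrdering Finset.univ L := hL ▸ (H.exists_ordering Finset.univ).choose_spec
  have : L.toFinset = Finset.univ := by
    ext v
    simp [h.mem_iff]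
  rw [← this, List.prod_toFinset _ h.nodup]
  rfl

lemma Wdag.IsOrdering.append {H : Wdag rel} {S : Finset (Fin H.n)} (hS : H.IsPrefix S)
    {L L' : List (Fin H.n)} (hL : H.IsOrdering S L) (hL' : H.IsOrdering Sᶜ L') :
    H.IsOrdering Finset.univ (L ++ L') := by
  refine ⟨List.nodup_append.2 ⟨hL.nodup, hL'.nodup, ?_⟩, fun v => ?_, ?_⟩
  · rintro u hu v hv rfl
    exact Finset.mem_compl.1 ((hL'.mem_iff u).1 hv) ((hL.mem_iff u).1 hu)
  · simp [hL.mem_iff, hL'.mem_iff, em]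
  · refine List.pairwise_append.2 ⟨hL.pairwise, hL'.pairwise, fun u hu v hv he => ?_⟩
    exact Finset.mem_compl.1 ((hL'.mem_iff v).1 hv) (hS v u he ((hL.mem_iff u).1 hu))

lemma Wdag.Iso.traceEq_word (hrefl : ∀ f, rel f f) (hsymm : ∀ f g, rel f g → rel g f)
    {G H : Wdag rel} (h : G.Iso H) : TraceEq rel G.word H.word := by
  obtain ⟨e, hlab, hedge⟩ := h
  have hG := (G.exists_ordering Finset.univ).choose_spec
  have hH : H.IsOrdering Finset.univ ((G.exists_ordering Finset.univ).choose.map e) := by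
    refine ⟨hG.nodup.map e.injective, fun v => ?_, ?_⟩
    · simp only [List.mem_map, Finset.mem_univ, iff_true]
      exact ⟨e.symm v, (hG.mem_iff _).2 (Finset.mem_univ _), by simp⟩
    · rw [List.pairwise_map]
      simpa only [hedge] using hG.pairwise
  have := hH.traceEq_word hrefl hsymm
  rw [List.map_map] at this
  rw [Wdag.word]
  convert this using 2
  funext v
  simp [hlab]

/-- The wdag of a word of flaws: its nodes are the positions in the word, and edges go from
earlier to later positions. -/
def Wdag.ofWord (hsymm : ∀ f g, rel f g → rel g f) (k : List F) : Wdag rel where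
  n := k.length
  label := k.get
  edge u v := u < v ∧ rel (k.get u) (k.get v)
  acyclic v hv := by
    have : ∀ u w, Relation.TransGen
        (fun u v : Fin k.length => u < v ∧ rel (k.get u) (k.get v)) u w → u < w := by
      intro u w h
      induction h with
      | single h => exact h.1
      | tail _ h ih => exact ih.trans h.1
    exact lt_irrefl v (this v v hv)
  edge_iff v w hne := by
    constructor
    · rintro (h | h)
      exacts [h.2, hsymm _ _ h.2]
    · intro h
      rcases lt_or_gt_of_ne hne with h' | h'
      exacts [Or.inl ⟨h', h⟩, Or.inr ⟨h', hsymm _ _ h⟩]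

lemma Wdag.traceEq_word_ofWord (hrefl : ∀ f, rel f f) (hsymm : ∀ f g, rel f g → rel g f)
    (k : List F) : TraceEq rel k (Wdag.ofWord hsymm k).word := by
  have h : (Wdag.ofWord hsymm k).IsOrdering Finset.univ (List.finRange k.length) := by
    refine ⟨List.nodup_finRange _, fun v => ?_, ?_⟩
    · simp only [Finset.mem_univ, iff_true]
      exact List.mem_finRange v
    · exact (List.pairwise_lt_finRange k.length).imp
        fun {u v} hlt (he : v < u ∧ rel (k.get v) (k.get u)) => lt_asymm hlt he.1
  have h2 := h.traceEq_word hrefl hsymm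
  have h3 : (List.finRange k.length).map (Wdag.ofWord hsymm k).label = k :=
    List.map_get_finRange k
  rwa [h3] at h2

lemma exists_class_traceEq (hrefl : ∀ f, rel f f) (hsymm : ∀ f g, rel f g → rel g f)
    (k : List F) : ∃ c : WdagClass rel, TraceEq rel k c.rep.word := by
  refine ⟨Quotient.mk (Wdag.setoid rel) (Wdag.ofWord hsymm k), ?_⟩
  refine (Wdag.traceEq_word_ofWord hrefl hsymm k).trans (TraceEq.symm ?_)
  have h : Wdag.Iso _ _ :=
    Quotient.exact (Quotient.out_eq (Quotient.mk (Wdag.setoid rel) (Wdag.ofWord hsymm k)))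
  exact h.traceEq_word hrefl hsymm

/-- Makes the union bound over minimal pairs a countable one. -/
instance [Countable F] : Countable (WdagClass rel) := by
  have : Countable (Wdag rel) := by
    refine Function.Injective.countable
      (β := Σ n : ℕ, (Fin n → F) × (Fin n → Fin n → Prop))
      (f := fun H => ⟨H.n, H.label, H.edge⟩) ?_
    rintro ⟨n, l, e, _, _⟩ ⟨n', l', e', _, _⟩ h
    simp only [Sigma.mk.injEq] at h
    obtain ⟨rfl, h⟩ := h
    simp only [heq_eq_eq, Prod.mk.injEq] at h
    obtain ⟨rfl, rfl⟩ := h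
    rfl
  exact inferInstanceAs (Countable (Quotient (Wdag.setoid rel)))

/-- In a factorisation `l = k m` of a trace whose second factor leads from `E` to `τ` and whose
first factor is as short as possible, the first factor is the wdag of an `E`-minimal pair. -/
lemma exists_minimalPair (hrefl : ∀ f, rel f f) (hsymm : ∀ f g, rel f g → rel g f)
    (hcomm : IsTCommutative R rel) {E : Set Ω} (l : List F) {τ : Ω} (hτ : τ ∈ E) :
    ∃ p ∈ minimalPairs rel R E, ∃ m, TraceEq rel l (p.1.rep.word ++ m) ∧
      0 < wordMat R m p.2 τ := by
  classical
  have hex : ∃ n, ∃ k : List F, k.length = n ∧ ∃ m, TraceEq rel l (k ++ m) ∧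
      ∃ ρ ∈ E, 0 < wordMat R m ρ τ :=
    ⟨_, l, rfl, [], by simpa using TraceEq.refl l, τ, hτ, by simp [wordMat, idMat]⟩
  obtain ⟨k, hk, m, hm, ρ, hρ, hpos⟩ := Nat.find_spec hex
  obtain ⟨c, hc⟩ := exists_class_traceEq hrefl hsymm k
  refine ⟨(c, ρ), ⟨hρ, ?_⟩, m, hm.trans (hc.append_right m), hpos⟩
  -- A strict prefix `S` violating minimality would give a shorter first factor: the labels outside
  -- `S` lead from some `ρ' ∈ E` to `ρ` and can be put in front of `m`.
  rintro ⟨S, hS, hne, hform⟩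
  obtain ⟨ρ', hρ', hpos'⟩ := form_ind_pos_iff.1 hform
  obtain ⟨L, hL⟩ := c.rep.exists_ordering S
  obtain ⟨L', hL'⟩ := c.rep.exists_ordering Sᶜ
  have hw := (hL.append hS hL').traceEq_word hrefl hsymm
  rw [hL'.subMat_eq hcomm] at hpos'
  have hlt : (L.map c.rep.label).length < Nat.find hex := by
    rw [← hk, hc.length_eq hrefl hsymm, Wdag.length_word, List.length_map, hL.length_eq]
    simpa using Finset.card_lt_univ_of_notMem
      (Classical.not_forall.1 fun h => hne (Finset.eq_univ_iff_forall.2 h)).choose_spec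
  refine Nat.find_min hex hlt ⟨_, rfl, L'.map c.rep.label ++ m, ?_, ρ', hρ', ?_⟩
  · rw [← List.append_assoc, ← List.map_append]
    exact hm.trans ((hc.trans hw.symm).append_right m)
  · rw [wordMat_append, mmul_pos_iff]
    exact ⟨ρ, hpos', hpos⟩

end Orderings

/-! ### Probability that a given factorisation appears in an execution. -/

section Executions

variable {Ω F W : Type*} {rel : F → F → Prop} {R : ResamplingOracle Ω F}

/-- The flaws in the list `l` are selected at the times `s, s + 1, …`. -/
def Selects (φ : ℕ → W → Option F) (ω : W) : ℕ → List F → Prop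
  | _, [] => True
  | s, f :: l => φ s ω = some f ∧ Selects φ ω (s + 1) l

/-- Some segment `l` of the execution which starts at time `s` and has at most `n` steps factors,
as a trace, into `k m` such that `m` leads from `ρ` to the state at the end of the segment. -/
def factorEvent (rel : F → F → Prop) (R : ResamplingOracle Ω F) (X : ℕ → W → Ω)
    (φ : ℕ → W → Option F) (s n : ℕ) (k : List F) (ρ : Ω) : Set W :=
  {ω | ∃ l m, l.length ≤ n ∧ Selects φ ω s l ∧ TraceEq rel l (k ++ m) ∧
    0 < wordMat R m ρ (X (s + l.length) ω)}

/-- The event that the states up to time `s` and the flaws selected before time `s` are given by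
`x` and `g`. -/
def stateHistory (X : ℕ → W → Ω) (φ : ℕ → W → Option F) (s : ℕ) (x : ℕ → Ω)
    (g : ℕ → Option F) : Set W :=
  {ω | (∀ r < s, X r ω = x r ∧ φ r ω = g r) ∧ X s ω = x s}

/-- The event that the states and the flaws selected up to time `s` are given by `x` and `g`. -/
def flawHistory (X : ℕ → W → Ω) (φ : ℕ → W → Option F) (s : ℕ) (x : ℕ → Ω)
    (g : ℕ → Option F) : Set W :=
  {ω | ∀ r ≤ s, X r ω = x r ∧ φ r ω = g r}

lemma factorEvent_mono {X : ℕ → W → Ω} {φ : ℕ → W → Option F} {s : ℕ} {k : List F} {ρ : Ω} :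
    Monotone fun n => factorEvent rel R X φ s n k ρ := by
  rintro n n' hn ω ⟨l, m, hl, h⟩
  exact ⟨l, m, hl.trans hn, h⟩

lemma flawHistory_inter_eq (X : ℕ → W → Ω) (φ : ℕ → W → Option F) (s : ℕ) (x : ℕ → Ω)
    (g : ℕ → Option F) (τ : Ω) :
    flawHistory X φ s x g ∩ {ω | X (s + 1) ω = τ} =
      stateHistory X φ (s + 1) (Function.update x (s + 1) τ) g := by
  ext ω
  simp only [flawHistory, stateHistory, Set.mem_inter_iff, Set.mem_ofPred_eq,
    Function.update_self, Nat.lt_succ_iff]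
  refine and_congr_left fun _ => forall₂_congr fun r hr => ?_
  rw [Function.update_of_ne (by omega)]

lemma flawHistory_update (X : ℕ → W → Ω) (φ : ℕ → W → Option F) (s : ℕ) (x : ℕ → Ω)
    (g : ℕ → Option F) (o : Option F) :
    flawHistory X φ s x (Function.update g s o) = stateHistory X φ s x g ∩ {ω | φ s ω = o} := by
  ext ω
  simp only [flawHistory, stateHistory, Set.mem_inter_iff, Set.mem_ofPred_eq]
  constructor
  · intro h
    refine ⟨⟨fun r hr => ?_, (h s le_rfl).1⟩, by simpa using (h s le_rfl).2⟩
    simpa [Function.update_of_ne hr.ne] using h r hr.le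
  · rintro ⟨⟨h, h'⟩, h''⟩ r hr
    rcases hr.eq_or_lt with rfl | hr
    · simp [h', h'']
    · simpa [Function.update_of_ne hr.ne] using h r hr

lemma selects_of_forall_isSome {φ : ℕ → W → Option F} {ω : W} {s t : ℕ}
    (h : ∀ r, s ≤ r → r < s + t → φ r ω ≠ none) :
    ∃ l, l.length = t ∧ Selects φ ω s l := by
  induction t generalizing s with
  | zero => exact ⟨[], rfl, trivial⟩
  | succ t ih =>
    obtain ⟨l, hl, hsel⟩ := ih (s := s + 1) fun r h1 h2 => h r (by omega) (by omega)
    obtain ⟨f, hf⟩ := Option.ne_none_iff_exists'.1 (h s le_rfl (by omega))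
    exact ⟨f :: l, by simp [hl], hf, hsel⟩

variable [MeasurableSpace W] {μ : PMF Ω} {ℙ : Measure W} {X : ℕ → W → Ω} {φ : ℕ → W → Option F}

/-- `trans` and `resample` differ only off the flaw, where selecting `f` has probability zero. -/
lemma IsExecution.measure_flawHistory_inter (hX : IsExecution R μ ℙ X φ) (s : ℕ) (x : ℕ → Ω)
    (g : ℕ → Option F) {f : F} (hf : g s = some f) (τ : Ω) :
    ℙ (flawHistory X φ s x g ∩ {ω | X (s + 1) ω = τ}) =
      ℙ (flawHistory X φ s x g) * R.trans f (x s) τ := by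
  have h := hX.step s x g f τ hf
  by_cases hx : x s ∈ R.flaw f
  · rw [ResamplingOracle.trans, if_pos hx]
    exact h
  · have h0 : ℙ (flawHistory X φ s x g) = 0 := by
      refine measure_mono_null (fun ω hω => ?_) (ae_iff.1 (hX.select s))
      intro hsel
      have := hω s le_rfl
      exact hx (this.1 ▸ hsel f (this.2.trans hf))
    rw [h0, zero_mul]
    exact measure_mono_null Set.inter_subset_left h0

lemma IsExecution.measurableSet_stateHistory (hX : IsExecution R μ ℙ X φ) (s : ℕ) (x : ℕ → Ω)
    (g : ℕ → Option F) : MeasurableSet (stateHistory X φ s x g) := by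
  have : stateHistory X φ s x g =
      (⋂ r ∈ Set.Iio s, {ω | X r ω = x r} ∩ {ω | φ r ω = g r}) ∩ {ω | X s ω = x s} := by
    ext ω
    simp [stateHistory]
  rw [this]
  exact (MeasurableSet.biInter (Set.to_countable _) fun r _ =>
    (hX.measurable_state r _).inter (hX.measurable_flaw r _)).inter (hX.measurable_state s _)

/-- After commuting, `A_k A_f` at `(σ, ρ')` has by injectivity the single term through `ρ`, and the
row of `A_f` at `ρ` sums to at most one. This pays for the union over the successors `ρ'` of `ρ`. -/
lemma tsum_mul_wordMat_le (hcomm : IsTCommutative R rel) (hinj : IsInjective R) {f : F}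
    {k : List F} (h : ∀ g ∈ k, ¬ rel f g) (σ ρ : Ω) :
    ∑' ρ' : {ρ' // 0 < R.trans f ρ ρ'}, mmul (R.trans f) (wordMat R k) σ ρ' ≤
      wordMat R k σ ρ := by
  rw [mmul_wordMat_comm hcomm h]
  have h1 : ∀ ρ' : {ρ' // 0 < R.trans f ρ ρ'},
      mmul (wordMat R k) (R.trans f) σ ρ' = wordMat R k σ ρ * R.trans f ρ ρ' := by
    rintro ⟨ρ', hρ'⟩
    refine tsum_eq_single ρ fun y hy => ?_
    by_contra hne
    exact hy (hinj f ρ' y ρ (pos_iff_ne_zero.2 (right_ne_zero_of_mul hne)) hρ')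
  rw [tsum_congr h1, ENNReal.tsum_mul_left]
  refine mul_le_of_le_one_right' ?_
  calc ∑' ρ' : {ρ' // 0 < R.trans f ρ ρ'}, R.trans f ρ ρ'
      ≤ ∑' ρ', R.trans f ρ ρ' := ENNReal.tsum_comp_le_tsum_of_injective Subtype.val_injective _
    _ ≤ ∑' ρ', R.resample f ρ ρ' := ENNReal.tsum_le_tsum fun ρ' => by
        rw [ResamplingOracle.trans]
        split_ifs
        · exact le_rfl
        · exact zero_le
    _ = 1 := PMF.tsum_coe _

/-- Almost surely, an event that ever occurs does so before the algorithm stops. -/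
lemma IsExecution.ae_exists_selects (hX : IsExecution R μ ℙ X φ) (E : Set Ω) :
    ∀ᵐ ω ∂ℙ, (∃ t, X t ω ∈ E) → ∃ l, Selects φ ω 0 l ∧ X l.length ω ∈ E := by
  filter_upwards [ae_all_iff.2 hX.select, ae_all_iff.2 hX.terminal, ae_all_iff.2 hX.halt]
    with ω hsel hterm hhalt
  classical
  intro hex
  obtain ⟨l, hl, h⟩ := selects_of_forall_isSome (φ := φ) (ω := ω) (s := 0) (t := Nat.find hex) <| by
    intro r _ hr hnone
    rw [Nat.zero_add] at hr
    -- If the run had stopped at a time `r` before the first visit to `E`, the state would stay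
    -- constant from `r` on, so `E` would already hold at time `r`.
    have hfrozen : ∀ j, φ (r + j) ω = none ∧ X (r + j) ω = X r ω := by
      intro j
      induction j with
      | zero => exact ⟨hnone, rfl⟩
      | succ j ih =>
        have h1 : X (r + (j + 1)) ω = X (r + j) ω := hhalt _ ih.1
        refine ⟨Option.eq_none_iff_forall_ne_some.2 fun f hf => ?_, h1.trans ih.2⟩
        exact hterm _ ih.1 f (h1 ▸ hsel _ f hf)
    have := (hfrozen (Nat.find hex - r)).2
    rw [Nat.add_sub_cancel' hr.le] at this
    exact Nat.find_min hex hr (this ▸ Nat.find_spec hex)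
  exact ⟨l, h, hl ▸ Nat.find_spec hex⟩

variable [Countable Ω]

/-- The induction step, given that `f` is selected at time `s`. Assumption `htriv` excludes the
factorisation of the empty segment, so the segment really begins with `f`. -/
lemma IsExecution.measure_flawHistory_factorEvent_le (hX : IsExecution R μ ℙ X φ)
    (hsymm : ∀ f g, rel f g → rel g f)
    (hrefl : ∀ f, rel f f) (hcomm : IsTCommutative R rel) (hinj : IsInjective R) {s n : ℕ}
    (ih : ∀ (x : ℕ → Ω) (g : ℕ → Option F) (k : List F) (ρ : Ω),
      ℙ (stateHistory X φ (s + 1) x g ∩ factorEvent rel R X φ (s + 1) n k ρ) ≤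
        ℙ (stateHistory X φ (s + 1) x g) * wordMat R k (x (s + 1)) ρ)
    (x : ℕ → Ω) (g : ℕ → Option F) {f : F} (hf : g s = some f) (k : List F) (ρ : Ω)
    (htriv : ¬ (k = [] ∧ ρ = x s)) :
    ℙ (flawHistory X φ s x g ∩ factorEvent rel R X φ s (n + 1) k ρ) ≤
      ℙ (flawHistory X φ s x g) * wordMat R k (x s) ρ := by
  have hstep : ∀ k' ρ' τ, ℙ ((flawHistory X φ s x g ∩ {ω | X (s + 1) ω = τ}) ∩
      factorEvent rel R X φ (s + 1) n k' ρ') ≤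
      ℙ (flawHistory X φ s x g) * (R.trans f (x s) τ * wordMat R k' τ ρ') := by
    intro k' ρ' τ
    rw [← mul_assoc, ← hX.measure_flawHistory_inter s x g hf τ, flawHistory_inter_eq]
    simpa using ih (Function.update x (s + 1) τ) g k' ρ'
  have hsum : ∀ k' ρ', ℙ (flawHistory X φ s x g ∩ factorEvent rel R X φ (s + 1) n k' ρ') ≤
      ℙ (flawHistory X φ s x g) * mmul (R.trans f) (wordMat R k') (x s) ρ' := by
    intro k' ρ'
    have hcover : flawHistory X φ s x g ∩ factorEvent rel R X φ (s + 1) n k' ρ' ⊆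
        ⋃ τ, (flawHistory X φ s x g ∩ {ω | X (s + 1) ω = τ}) ∩
          factorEvent rel R X φ (s + 1) n k' ρ' :=
      fun ω hω => Set.mem_iUnion.2 ⟨X (s + 1) ω, ⟨hω.1, rfl⟩, hω.2⟩
    refine (measure_mono hcover).trans ((measure_iUnion_le _).trans ?_)
    rw [mmul, ← ENNReal.tsum_mul_left]
    exact ENNReal.tsum_le_tsum fun τ => hstep k' ρ' τ
  have hfirst : ∀ ω ∈ flawHistory X φ s x g ∩ factorEvent rel R X φ s (n + 1) k ρ,
      ∃ l m, l.length ≤ n ∧ Selects φ ω (s + 1) l ∧ TraceEq rel (f :: l) (k ++ m) ∧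
        0 < wordMat R m ρ (X (s + 1 + l.length) ω) := by
    rintro ω ⟨hω, l, m, hl, hsel, htr, hpos⟩
    cases l with
    | nil =>
      have hkm : k ++ m = [] := by
        by_contra hne
        obtain ⟨a, t, hat⟩ := List.exists_cons_of_ne_nil hne
        rw [hat] at htr
        simpa using htr.symm.mem_of_cons hrefl
      obtain ⟨rfl, rfl⟩ := List.append_eq_nil_iff.1 hkm
      refine absurd ⟨rfl, ?_⟩ htriv
      have h1 : ρ = X s ω := by simpa [wordMat, idMat, pos_iff_ne_zero] using hpos
      exact h1.trans (hω s le_rfl).1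
    | cons f' l =>
      obtain rfl : f = f' := Option.some_injective _ (((hω s le_rfl).2.trans hf).symm.trans hsel.1)
      refine ⟨l, m, by simpa using hl, hsel.2, htr, ?_⟩
      rwa [List.length_cons, Nat.add_comm l.length, ← Nat.add_assoc] at hpos
  by_cases hfk : f ∈ k
  · obtain ⟨k₁, k₂, rfl, hf₁⟩ := List.eq_append_cons_of_mem hfk
    -- The first letter of the segment must match the first `f` in `k`; if a related letter precedes
    -- it there, the event is empty.
    by_cases hk : ∀ g ∈ k₁, ¬ rel f g
    · rw [wordMat_move_front hcomm _ hk]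
      refine (measure_mono fun ω hω => ?_).trans (hsum (k₁ ++ k₂) ρ)
      obtain ⟨l, m, hl, hsel, htr, hpos⟩ := hfirst ω hω
      rw [List.append_assoc, List.cons_append] at htr
      refine ⟨hω.1, l, m, hl, hsel, ?_, hpos⟩
      rw [List.append_assoc]
      exact (htr.cancel_head hsymm hf₁).2
    · refine (measure_mono_null (fun ω hω => ?_) measure_empty).trans_le zero_le
      obtain ⟨l, m, hl, hsel, htr, hpos⟩ := hfirst ω hω
      rw [List.append_assoc, List.cons_append] at htr
      exact hk (htr.cancel_head hsymm hf₁).1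
  · by_cases hk : ∀ g ∈ k, ¬ rel f g
    · have hsub : flawHistory X φ s x g ∩ factorEvent rel R X φ s (n + 1) k ρ ⊆
          ⋃ ρ' : {ρ' // 0 < R.trans f ρ ρ'},
            flawHistory X φ s x g ∩ factorEvent rel R X φ (s + 1) n k ρ' := by
        intro ω hω
        obtain ⟨l, m, hl, hsel, htr, hpos⟩ := hfirst ω hω
        obtain ⟨m₁, m₂, rfl, hm₁⟩ := List.eq_append_cons_of_mem
          ((List.mem_append.1 (htr.mem_of_cons hrefl)).resolve_left hfk)
        rw [← List.append_assoc] at htr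
        obtain ⟨h1, h2⟩ := htr.cancel_head hsymm (by simp [hfk, hm₁])
        rw [wordMat_move_front hcomm _ fun g hg => h1 g (by simp [hg]), mmul_pos_iff] at hpos
        obtain ⟨ρ', hρ', hpos⟩ := hpos
        refine Set.mem_iUnion.2 ⟨⟨ρ', hρ'⟩, hω.1, l, m₁ ++ m₂, hl, hsel, ?_, hpos⟩
        rwa [← List.append_assoc]
      refine (measure_mono hsub).trans ((measure_iUnion_le _).trans ?_)
      refine (ENNReal.tsum_le_tsum fun ρ' : {ρ' // 0 < R.trans f ρ ρ'} => hsum k ρ').trans ?_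
      rw [ENNReal.tsum_mul_left]
      exact mul_le_mul_right (tsum_mul_wordMat_le hcomm hinj hk _ _) _
    · refine (measure_mono_null (fun ω hω => ?_) measure_empty).trans_le zero_le
      obtain ⟨l, m, hl, hsel, htr, hpos⟩ := hfirst ω hω
      obtain ⟨m₁, m₂, rfl, hm₁⟩ := List.eq_append_cons_of_mem
        ((List.mem_append.1 (htr.mem_of_cons hrefl)).resolve_left hfk)
      rw [← List.append_assoc] at htr
      exact hk fun g hg => (htr.cancel_head hsymm (by simp [hfk, hm₁])).1 g (by simp [hg])

variable [Countable F]

lemma IsExecution.measure_stateHistory_factorEvent_le (hX : IsExecution R μ ℙ X φ)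
    (hsymm : ∀ f g, rel f g → rel g f)
    (hrefl : ∀ f, rel f f) (hcomm : IsTCommutative R rel) (hinj : IsInjective R) (s n : ℕ)
    (x : ℕ → Ω) (g : ℕ → Option F) (k : List F) (ρ : Ω) :
    ℙ (stateHistory X φ s x g ∩ factorEvent rel R X φ s n k ρ) ≤
      ℙ (stateHistory X φ s x g) * wordMat R k (x s) ρ := by
  induction n generalizing s x g k ρ with
  | zero =>
    by_cases htriv : k = [] ∧ ρ = x s
    · obtain ⟨rfl, rfl⟩ := htriv
      simpa [wordMat, idMat] using measure_mono Set.inter_subset_left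
    · refine (measure_mono_null (fun ω hω => ?_) measure_empty).trans_le zero_le
      obtain ⟨hω, l, m, hl, hsel, htr, hpos⟩ := hω
      obtain rfl : l = [] := List.length_eq_zero_iff.1 (Nat.le_zero.1 hl)
      have hlen := htr.length_eq hrefl hsymm
      obtain ⟨rfl, rfl⟩ := List.append_eq_nil_iff.1 (List.length_eq_zero_iff.1 hlen.symm)
      have h1 : ρ = X s ω := by simpa [wordMat, idMat, pos_iff_ne_zero] using hpos
      exact htriv ⟨rfl, h1.trans hω.2⟩
  | succ n ih =>
    by_cases htriv : k = [] ∧ ρ = x s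
    · obtain ⟨rfl, rfl⟩ := htriv
      simpa [wordMat, idMat] using measure_mono Set.inter_subset_left
    · have hsub : stateHistory X φ s x g ∩ factorEvent rel R X φ s (n + 1) k ρ ⊆
          ⋃ f : F, flawHistory X φ s x (Function.update g s (some f)) ∩
            factorEvent rel R X φ s (n + 1) k ρ := by
        intro ω hω
        have hw := hω.2
        obtain ⟨l, m, hl, hsel, htr, hpos⟩ := hω.2
        cases l with
        | nil =>
          have hlen := htr.length_eq hrefl hsymm
          obtain ⟨rfl, rfl⟩ := List.append_eq_nil_iff.1 (List.length_eq_zero_iff.1 hlen.symm)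
          have h1 : ρ = X s ω := by simpa [wordMat, idMat, pos_iff_ne_zero] using hpos
          exact absurd ⟨rfl, h1.trans hω.1.2⟩ htriv
        | cons f l =>
          refine Set.mem_iUnion.2 ⟨f, ?_, hw⟩
          rw [flawHistory_update]
          exact ⟨hω.1, hsel.1⟩
      refine (measure_mono hsub).trans ((measure_iUnion_le _).trans ?_)
      refine (ENNReal.tsum_le_tsum fun f =>
        hX.measure_flawHistory_factorEvent_le hsymm hrefl hcomm hinj (ih (s + 1)) x
          (Function.update g s (some f)) (f := f) (by simp) k ρ htriv).trans ?_
      rw [ENNReal.tsum_mul_right]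
      refine mul_le_mul_left ?_ _
      simp only [flawHistory_update]
      -- The histories for different selected flaws are disjoint, so nothing is lost in summing over
      -- an arbitrary selection rule.
      rw [← measure_iUnion]
      · exact measure_mono (Set.iUnion_subset fun f => Set.inter_subset_left)
      · intro f f' hne
        refine Set.disjoint_left.2 fun ω h h' => hne ?_
        exact Option.some_injective _ (h.2.symm.trans h'.2)
      · exact fun f => (hX.measurableSet_stateHistory s x g).inter (hX.measurable_flaw s _)

lemma IsExecution.measure_iUnion_factorEvent_le (hX : IsExecution R μ ℙ X φ)
    (hsymm : ∀ f g, rel f g → rel g f)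
    (hrefl : ∀ f, rel f f) (hcomm : IsTCommutative R rel) (hinj : IsInjective R)
    (k : List F) (ρ : Ω) :
    ℙ (⋃ n, factorEvent rel R X φ 0 n k ρ) ≤ ∑' σ, μ σ * wordMat R k σ ρ := by
  rw [factorEvent_mono.measure_iUnion]
  refine iSup_le fun n => ?_
  have hcover : factorEvent rel R X φ 0 n k ρ ⊆
      ⋃ σ, stateHistory X φ 0 (fun _ => σ) (fun _ => none) ∩ factorEvent rel R X φ 0 n k ρ :=
    fun ω hω => Set.mem_iUnion.2 ⟨X 0 ω, by simp [stateHistory], hω⟩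
  refine (measure_mono hcover).trans ((measure_iUnion_le _).trans ?_)
  refine ENNReal.tsum_le_tsum fun σ =>
    (hX.measure_stateHistory_factorEvent_le hsymm hrefl hcomm hinj 0 n _ _ k ρ).trans_eq ?_
  simp [stateHistory, hX.init]

lemma IsExecution.occurProb_le (hX : IsExecution R μ ℙ X φ) (hsymm : ∀ f g, rel f g → rel g f)
    (hrefl : ∀ f, rel f f) (hcomm : IsTCommutative R rel) (hinj : IsInjective R) (E : Set Ω) :
    occurProb ℙ X E ≤
      ∑' p : minimalPairs rel R E, form μ (p.1.1.rep.mat R) (ind {p.1.2}) := by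
  have hle : occurProb ℙ X E ≤ ℙ (⋃ p : minimalPairs rel R E,
      ⋃ n, factorEvent rel R X φ 0 n p.1.1.rep.word p.1.2) := by
    refine measure_mono_ae ?_
    filter_upwards [hX.ae_exists_selects E] with ω hω hE
    obtain ⟨l, hsel, hl⟩ := hω hE
    obtain ⟨p, hp, m, htr, hpos⟩ := exists_minimalPair hrefl hsymm hcomm l hl
    refine Set.mem_iUnion.2 ⟨⟨p, hp⟩, Set.mem_iUnion.2 ⟨l.length, l, m, le_rfl, hsel, htr, ?_⟩⟩
    rwa [Nat.zero_add]
  refine hle.trans ((measure_iUnion_le _).trans (ENNReal.tsum_le_tsum fun p => ?_))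
  rw [form_ind_singleton, Wdag.mat_eq hcomm]
  exact hX.measure_iUnion_factorEvent_le hsymm hrefl hcomm hinj _ _

end Executions

/-! ### Charges, weights and sums over sink sets. -/

section Charges

variable {Ω F : Type*} {rel : F → F → Prop} {R : ResamplingOracle Ω F} {μ : PMF Ω}

lemma tsum_mul_trans_le (hμ : ChargesDefined R μ) (f : F) (τ : Ω) :
    ∑' σ, μ σ * R.trans f σ τ ≤ charge R μ f * μ τ := by
  by_cases hτ : μ τ = 0
  -- When `μ τ = 0` the charge gives no control; the left side vanishes termwise by
  -- `ChargesDefined`.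
  · rw [hτ, mul_zero, nonpos_iff_eq_zero, ENNReal.tsum_eq_zero]
    intro σ
    by_contra hne
    exact (hμ f σ τ (pos_iff_ne_zero.2 (left_ne_zero_of_mul hne))
      (pos_iff_ne_zero.2 (right_ne_zero_of_mul hne))).ne' hτ
  · have hle : ∑' σ, μ σ / μ τ * R.trans f σ τ ≤ charge R μ f := by
      refine le_of_eq_of_le ?_ (le_iSup _ τ)
      refine (tsum_subtype_eq_of_support_subset (f := fun σ => μ σ / μ τ * R.trans f σ τ)
        fun σ hσ => ?_).symm
      by_contra hflaw
      exact hσ (by simp [ResamplingOracle.trans, hflaw])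
    refine le_of_eq_of_le ?_ (mul_le_mul_left hle (μ τ))
    rw [← ENNReal.tsum_mul_right]
    refine tsum_congr fun σ => ?_
    rw [mul_right_comm, ENNReal.div_mul_cancel hτ (μ.apply_ne_top τ)]

/-- Letters are split off at the right end because `μ` multiplies from the left as a row vector. -/
lemma tsum_mul_wordMat_le_prod (hμ : ChargesDefined R μ) (k : List F) (τ : Ω) :
    ∑' σ, μ σ * wordMat R k σ τ ≤ μ τ * (k.map (charge R μ)).prod := by
  induction k using List.reverseRecOn generalizing τ with
  | nil =>
    rw [tsum_eq_single τ]
    · simp [wordMat, idMat]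
    · intro σ hσ
      simp [wordMat, idMat, hσ]
  | append_singleton k f ih =>
    have hf : wordMat R [f] = R.trans f := by simp [wordMat, mmul_idMat]
    rw [List.map_append, List.prod_append, wordMat_append, hf]
    calc ∑' σ, μ σ * mmul (wordMat R k) (R.trans f) σ τ
        = ∑' ρ, (∑' σ, μ σ * wordMat R k σ ρ) * R.trans f ρ τ := by
          simp only [mmul, ← ENNReal.tsum_mul_left, ← ENNReal.tsum_mul_right]
          rw [ENNReal.tsum_comm]
          simp only [mul_assoc]
      _ ≤ ∑' ρ, (k.map (charge R μ)).prod * (μ ρ * R.trans f ρ τ) := by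
          refine ENNReal.tsum_le_tsum fun ρ => ?_
          refine (mul_le_mul_left (ih ρ) _).trans_eq ?_
          ring
      _ ≤ (k.map (charge R μ)).prod * (charge R μ f * μ τ) := by
          rw [ENNReal.tsum_mul_left]
          exact mul_le_mul_right (tsum_mul_trans_le hμ f τ) _
      _ = μ τ * ((k.map (charge R μ)).prod * ([f].map (charge R μ)).prod) := by
          simp only [List.map_cons, List.map_nil, List.prod_cons, List.prod_nil]
          ring

lemma form_mat_le_weight (hcomm : IsTCommutative R rel) (hμ : ChargesDefined R μ) (H : Wdag rel)
    (σ : Ω) : form μ (H.mat R) (ind {σ}) ≤ μ σ * H.weight R μ := by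
  rw [form_ind_singleton, Wdag.mat_eq hcomm, Wdag.weight_eq]
  exact tsum_mul_wordMat_le_prod hμ _ _

lemma PsiBar_eq_tsum (I : Set F) :
    PsiBar rel R μ I = ∑' c : {c : WdagClass rel // c.rep.sink ⊆ I}, c.1.rep.weight R μ := by
  rw [PsiBar]
  simp only [Psi]
  rw [← ENNReal.tsum_sigma
    (fun (J : {J : Set F // J ⊆ I}) (c : {c : WdagClass rel // c.rep.sink = J.1}) =>
      c.1.rep.weight R μ)]
  let e : (Σ J : {J : Set F // J ⊆ I}, {c : WdagClass rel // c.rep.sink = J.1}) ≃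
      {c : WdagClass rel // c.rep.sink ⊆ I} :=
    { toFun := fun p => ⟨p.2.1, p.2.2.trans_subset p.1.2⟩
      invFun := fun c => ⟨⟨c.1.rep.sink, c.2⟩, ⟨c.1, rfl⟩⟩
      left_inv := by
        rintro ⟨⟨J, hJ⟩, ⟨c, hc⟩⟩
        cases hc
        rfl
      right_inv := fun _ => rfl }
  exact e.tsum_eq fun c : {c : WdagClass rel // c.rep.sink ⊆ I} => c.1.rep.weight R μ

lemma PsiBar_mono {I J : Set F} (h : I ⊆ J) : PsiBar rel R μ I ≤ PsiBar rel R μ J := by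
  rw [PsiBar_eq_tsum, PsiBar_eq_tsum]
  exact ENNReal.tsum_comp_le_tsum_of_injective
    (f := fun c : {c : WdagClass rel // c.rep.sink ⊆ I} =>
      (⟨c.1, c.2.trans h⟩ : {c : WdagClass rel // c.rep.sink ⊆ J}))
    (fun a b hab => Subtype.ext (congrArg (fun c => c.1) hab))
    (fun c => c.1.rep.weight R μ)

/-- If every sink label of the first component of an `E`-minimal pair can lead to the second
component, then these labels can cause `E` there. -/
lemma IsMinimalPair.sink_subset_causesAt (hcomm : IsTCommutative R rel) {E : Set Ω} {H : Wdag rel}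
    {σ : Ω} (h : IsMinimalPair R E H σ) (hlead : ∀ f ∈ H.sink, ∃ τ, 0 < R.trans f τ σ) :
    H.sink ⊆ causesAt R E σ := by
  rintro f ⟨v, hv, rfl⟩
  obtain ⟨τ, hτ⟩ := hlead _ ⟨v, hv, rfl⟩
  refine ⟨τ, fun hE => h.2 ⟨{v}ᶜ, ?_, ?_, ?_⟩, hτ⟩
  · intro u w he _
    simp only [Finset.mem_compl, Finset.mem_singleton]
    rintro rfl
    exact hv _ he
  · simp
  · have hord : H.IsOrdering {v} [v] := ⟨by simp, by simp, by simp⟩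
    rw [form_ind_pos_iff, compl_compl, hord.subMat_eq hcomm]
    exact ⟨τ, hE, by simpa [wordMat, mmul_idMat] using hτ⟩

/-- A sink can be listed last in a topological order, so `A_H` has the matrix of its label as
rightmost factor. -/
lemma Wdag.exists_trans_pos_of_mem_sink (hcomm : IsTCommutative R rel) {H : Wdag rel} {σ : Ω}
    (h : ∃ ρ, 0 < H.mat R ρ σ) {f : F} (hf : f ∈ H.sink) : ∃ τ, 0 < R.trans f τ σ := by
  obtain ⟨v, hv, rfl⟩ := hf
  obtain ⟨ρ, hρ⟩ := h
  have hpre : H.IsPrefix {v}ᶜ := by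
    intro u w he _
    simp only [Finset.mem_compl, Finset.mem_singleton]
    rintro rfl
    exact hv _ he
  have hord : H.IsOrdering ({v}ᶜ)ᶜ [v] := ⟨by simp, by simp, by simp⟩
  obtain ⟨L, hL⟩ := H.exists_ordering {v}ᶜ
  rw [Wdag.mat, (hL.append hpre hord).subMat_eq hcomm, List.map_append, wordMat_append,
    mmul_pos_iff] at hρ
  obtain ⟨τ, _, hτ⟩ := hρ
  exact ⟨τ, by simpa [wordMat, mmul_idMat] using hτ⟩

lemma tsum_weight_le_tsum_PsiBar {ι : Type*} {E : Set Ω} {I : Ω → Set F}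
    (p : ι → WdagClass rel × Ω) (hp : Function.Injective p) (hE : ∀ i, (p i).2 ∈ E)
    (hI : ∀ i, (p i).1.rep.sink ⊆ I (p i).2) :
    ∑' i, μ (p i).2 * (p i).1.rep.weight R μ ≤ ∑' σ : E, μ σ * PsiBar rel R μ (I σ) := by
  simp only [PsiBar_eq_tsum, ← ENNReal.tsum_mul_left]
  rw [← ENNReal.tsum_sigma (fun (σ : E) (c : {c : WdagClass rel // c.rep.sink ⊆ I σ}) =>
    μ σ * c.1.rep.weight R μ)]
  refine ENNReal.tsum_comp_le_tsum_of_injective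
    (f := fun i => (⟨⟨(p i).2, hE i⟩, ⟨(p i).1, hI i⟩⟩ :
      Σ σ : E, {c : WdagClass rel // c.rep.sink ⊆ I σ})) ?_
    (fun q => μ q.1 * q.2.1.rep.weight R μ)
  intro i j hij
  apply hp
  have h2 : (p i).2 = (p j).2 := congrArg (fun q => (q.1 : Ω)) hij
  have h1 : (p i).1 = (p j).1 := congrArg (fun q => q.2.1) hij
  exact Prod.ext h1 h2

lemma tsum_mul_le_prob_mul_iSup (E : Set Ω) (u : Ω → ℝ≥0∞) :
    ∑' σ : E, μ σ * u σ ≤ prob μ E * ⨆ σ ∈ E, u σ := by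
  rw [prob, ← ENNReal.tsum_mul_right]
  exact ENNReal.tsum_le_tsum fun σ => mul_le_mul_right (le_iSup₂ (f := fun τ _ => u τ) σ.1 σ.2) _

end Charges

end LocalSearch

end

/-! ### Assembly of the bounds. -/

theorem theorem5p6 {Ω F W : Type*} [Countable Ω] [Countable F] [MeasurableSpace W]
    (R : LocalSearch.ResamplingOracle Ω F) (rel : F → F → Prop)
    (hrel : LocalSearch.IsDependence R rel)
    (hcomm : LocalSearch.IsTCommutative R rel)
    (hinj : LocalSearch.IsInjective R)
    (μ : PMF Ω)
    (ℙ : MeasureTheory.Measure W) [MeasureTheory.IsProbabilityMeasure ℙ]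
    (X : ℕ → W → Ω) (φ : ℕ → W → Option F)
    (hX : LocalSearch.IsExecution R μ ℙ X φ) :
    (∀ E : Set Ω,
      LocalSearch.occurProb ℙ X E ≤
        ∑' p : LocalSearch.minimalPairs rel R E,
          LocalSearch.form μ (p.1.1.rep.mat R) (LocalSearch.ind {p.1.2})) ∧
    (LocalSearch.ChargesDefined R μ →
      (∀ E : Set Ω,
        LocalSearch.occurProb ℙ X E ≤
          ∑' p : LocalSearch.minimalPairs rel R E, μ p.1.2 * p.1.1.rep.weight R μ ∧
        -- the pairs `(H, σ)` in `𝔄(E)` with `A_H e_σ ≠ 0` suffice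
        LocalSearch.occurProb ℙ X E ≤
          ∑' p : {p : LocalSearch.minimalPairs rel R E // ∃ ρ, 0 < p.1.1.rep.mat R ρ p.1.2},
            μ p.1.1.2 * p.1.1.1.rep.weight R μ ∧
        ∑' p : {p : LocalSearch.minimalPairs rel R E // ∃ ρ, 0 < p.1.1.rep.mat R ρ p.1.2},
            μ p.1.1.2 * p.1.1.1.rep.weight R μ ≤
          ∑' σ : E, μ σ * LocalSearch.PsiBar rel R μ (LocalSearch.causesAt R E σ) ∧
        -- if every flaw can lead to every state of `E`, this restriction can be omitted
        ((∀ f, ∀ σ ∈ E, ∃ τ, 0 < R.trans f τ σ) →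
          ∑' p : LocalSearch.minimalPairs rel R E, μ p.1.2 * p.1.1.rep.weight R μ ≤
            ∑' σ : E, μ σ * LocalSearch.PsiBar rel R μ (LocalSearch.causesAt R E σ)) ∧
        ∑' σ : E, μ σ * LocalSearch.PsiBar rel R μ (LocalSearch.causesAt R E σ) ≤
          LocalSearch.prob μ E *
            (⨆ σ ∈ E, LocalSearch.PsiBar rel R μ (LocalSearch.causesAt R E σ)) ∧
        LocalSearch.occurProb ℙ X E ≤
          LocalSearch.prob μ E *
            (⨆ σ ∈ E, LocalSearch.PsiBar rel R μ (LocalSearch.causesAt R E σ))) ∧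
      (∀ 𝒞 : Set (Set Ω),
        LocalSearch.occurProb ℙ X (⋃₀ 𝒞) ≤
          LocalSearch.prob μ (⋃₀ 𝒞) *
            (⨆ C ∈ 𝒞, LocalSearch.PsiBar rel R μ (LocalSearch.causes R C)))) := by
  have hrefl := hrel.refl
  have hsymm := hrel.symm
  have hfirst := hX.occurProb_le hsymm hrefl hcomm hinj
  refine ⟨hfirst, fun hμ => ?_⟩
  have hrestr : ∀ E : Set Ω, LocalSearch.occurProb ℙ X E ≤
      ∑' p : {p : LocalSearch.minimalPairs rel R E // ∃ ρ, 0 < p.1.1.rep.mat R ρ p.1.2},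
        μ p.1.1.2 * p.1.1.1.rep.weight R μ := by
    intro E
    refine (hfirst E).trans (le_of_eq_of_le ?_ (ENNReal.tsum_le_tsum fun p =>
      LocalSearch.form_mat_le_weight hcomm hμ p.1.1.1.rep p.1.1.2))
    -- Pairs with `A_H e_σ = 0` contribute nothing to the first bound, so they are dropped before
    -- passing to weights.
    refine (tsum_subtype_eq_of_support_subset
      (f := fun p : LocalSearch.minimalPairs rel R E =>
        LocalSearch.form μ (p.1.1.rep.mat R) (LocalSearch.ind {p.1.2}))
      (s := {p | ∃ ρ, 0 < p.1.1.rep.mat R ρ p.1.2}) fun p hp => ?_).symm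
    rw [Function.mem_support, LocalSearch.form_ind_singleton, Ne, ENNReal.tsum_eq_zero] at hp
    obtain ⟨ρ, hρ⟩ := not_forall.1 hp
    exact ⟨ρ, pos_iff_ne_zero.2 (right_ne_zero_of_mul hρ)⟩
  have hpsi : ∀ E : Set Ω,
      ∑' p : {p : LocalSearch.minimalPairs rel R E // ∃ ρ, 0 < p.1.1.rep.mat R ρ p.1.2},
        μ p.1.1.2 * p.1.1.1.rep.weight R μ ≤
      ∑' σ : E, μ σ * LocalSearch.PsiBar rel R μ (LocalSearch.causesAt R E σ) := by
    intro E
    exact LocalSearch.tsum_weight_le_tsum_PsiBar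
      (fun p : {p : LocalSearch.minimalPairs rel R E // ∃ ρ, 0 < p.1.1.rep.mat R ρ p.1.2} => p.1.1)
      (fun p q h => Subtype.ext (Subtype.ext h)) (fun p => p.1.2.1)
      (fun p => p.1.2.sink_subset_causesAt hcomm fun f hf =>
        LocalSearch.Wdag.exists_trans_pos_of_mem_sink hcomm p.2 hf)
  have hsup : ∀ E : Set Ω, LocalSearch.occurProb ℙ X E ≤ LocalSearch.prob μ E *
      (⨆ σ ∈ E, LocalSearch.PsiBar rel R μ (LocalSearch.causesAt R E σ)) := fun E =>
    (hrestr E).trans ((hpsi E).trans (LocalSearch.tsum_mul_le_prob_mul_iSup E _))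
  refine ⟨fun E => ⟨?_, hrestr E, hpsi E, fun hlead => ?_,
    LocalSearch.tsum_mul_le_prob_mul_iSup E _, hsup E⟩, fun 𝒞 => ?_⟩
  · exact (hfirst E).trans (ENNReal.tsum_le_tsum fun p =>
      LocalSearch.form_mat_le_weight hcomm hμ _ _)
  · exact LocalSearch.tsum_weight_le_tsum_PsiBar
      (fun p : LocalSearch.minimalPairs rel R E => p.1) Subtype.val_injective (fun p => p.2.1)
      (fun p => p.2.sink_subset_causesAt hcomm fun f _ => hlead f _ p.2.1)
  · refine (hsup _).trans (mul_le_mul_right (iSup₂_le ?_) _)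
    rintro σ ⟨C, hC, hσ⟩
    -- For `σ ∈ C`, a flaw leading to `σ` from outside the union leads there from outside `C`.
    refine (LocalSearch.PsiBar_mono ?_).trans
      (le_iSup₂ (f := fun C _ => LocalSearch.PsiBar rel R μ (LocalSearch.causes R C)) C hC)
    rintro f ⟨τ, hτ, hpos⟩
    exact Set.mem_biUnion hσ ⟨τ, fun h => hτ ⟨C, hC, h⟩, hpos⟩
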